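/- Let $m\ge 1$ be an integer, let $K\subset\mathbb{R}$ be a real algebraic number field of degree $m+1$ over $\mathbb{Q}$, and let $\alpha_1,\dots,\alpha_m\in K$ be such that $1,\alpha_1,\dots,\alpha_m$ are linearly independent over $\mathbb{Q}$. Put $\mathbf{v}=(1,\alpha_1,\dots,\alpha_m)\in\mathbb{R}^{m+1}$. Then every torus half-line with direction $\mathbf{v}$ is superdense in the unit cube $[0,1)^{m+1}$, with a constant that depends only on $\mathbf{v}$: there is a constant $C=C(\mathbf{v})>0$ such that for every starting point $\mathbf{s}\in\mathbb{R}^{m+1}$, every integer $n\ge 1$ and every point $P\in[0,1)^{m+1}$, the initial segment of length $Cn^{m}$ of the torus half-line $t\mapsto \mathbf{s}+t\mathbf{v} \bmod 1$ $(t\ge 0)$, viewed in $[0,1)^{m+1}$, contains a point at Euclidean distance at most $1/n$ from $P$. -/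

import Mathlib

/-- The half-open unit cube `[0,1)^d` in Euclidean space. -/
def unitCube (d : ℕ) : Set (EuclideanSpace ℝ (Fin d)) :=
  {x | ∀ i, x i ∈ Set.Ico (0 : ℝ) 1}

/-- The position in the cube `[0,1)^d`, at time `t`, of the torus line which starts at `s` and has
direction vector `v`, that is, `s + t v` taken modulo one in every coordinate. -/
noncomputable def torusLine {d : ℕ} (s v : EuclideanSpace ℝ (Fin d)) (t : ℝ) :
    EuclideanSpace ℝ (Fin d) :=
  WithLp.toLp 2 fun i => Int.fract (s i + t * v i)

/-- The initial segment of length `L` of the torus half-line `t ↦ s + t v mod 1`, `0 ≤ t`.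
The motion has Euclidean speed `‖v‖`, so the part traversed up to time `t` has length `t * ‖v‖`. -/
def initialSegment {d : ℕ} (s v : EuclideanSpace ℝ (Fin d)) (L : ℝ) :
    Set (EuclideanSpace ℝ (Fin d)) :=
  {x | ∃ t : ℝ, 0 ≤ t ∧ t * ‖v‖ ≤ L ∧ torusLine s v t = x}

/-- The torus half-line with starting point `s` and direction `v` is superdense in `[0,1)^d`,
with constant `C`: for every integer `n ≥ 1` and every point `P` of the cube, the initial segment
of length `C n^(d-1)` gets `(1/n)`-close to `P` (in the Euclidean distance of the cube itself).
Only meant for `1 ≤ d`. -/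
def SuperdenseWith {d : ℕ} (C : ℝ) (s v : EuclideanSpace ℝ (Fin d)) : Prop :=
  ∀ n : ℕ, 1 ≤ n → ∀ P ∈ unitCube d,
    ∃ x ∈ initialSegment s v (C * (n : ℝ) ^ (d - 1)), dist x P ≤ 1 / (n : ℝ)

/-! Dirichlet gives an integer vector `p` within O(1/N) of `q v`, with 0 < q ≤ N^m. Multiplication
by `D v i` in `K` acts by an integer matrix `A i` with eigenvector `v`, so every `A i *ᵥ p` is again
an integer vector within O(1/N) of the line ℝv, at parameter O(N^m). These m+1 vectors are
independent (`det_mulVec_ne_zero`), so translates of the thin parallelepiped they span tile space by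
integer vectors (`exists_covering`). Hence every point is, mod 1, close to a short segment of the
line. -/

/-- If the coordinates of `v` form a `ℚ`-basis of a number field, then multiplication by a common
multiple of each coordinate is given by an integer matrix having `v` as an eigenvector. -/
theorem exists_int_matrix_mulVec_eq_smul {ι : Type*} [Fintype ι] [Nonempty ι]
    (K : IntermediateField ℚ ℝ)
    (hK : Module.finrank ℚ K = Fintype.card ι) (v : ι → ℝ) (hv : ∀ i, v i ∈ K)
    (hlin : LinearIndependent ℚ v) :
    ∃ D : ℤ, D ≠ 0 ∧ ∃ A : ι → Matrix ι ι ℤ,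
      ∀ i k, ∑ j, (A i k j : ℝ) * v j = D * v i * v k := by
  have : FiniteDimensional ℚ K := Module.finite_of_finrank_pos (hK ▸ Fintype.card_pos)
  have : FiniteDimensional ℚ (Subalgebra.toSubmodule K.toSubalgebra) := this
  have hspan : Submodule.span ℚ (Set.range v) = Subalgebra.toSubmodule K.toSubalgebra := by
    refine Submodule.eq_of_le_of_finrank_eq ?_ ?_
    · rw [Submodule.span_le]
      rintro _ ⟨i, rfl⟩
      exact hv i
    · rw [finrank_span_eq_card hlin]
      exact hK.symm
  have hc : ∀ i k, ∃ c : ι → ℚ, ∑ j, c j • v j = v i * v k := fun i k => by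
    rw [← Submodule.mem_span_range_iff_exists_fun, hspan]
    exact K.mul_mem (hv i) (hv k)
  choose c hc using hc
  obtain ⟨⟨D, hD⟩, hint⟩ := IsLocalization.exist_integer_multiples_of_finite
    (nonZeroDivisors ℤ) (fun x : ι × ι × ι => c x.1 x.2.1 x.2.2)
  choose a ha using hint
  refine ⟨D, nonZeroDivisors.ne_zero hD, fun i k j => a (i, k, j), fun i k => ?_⟩
  rw [mul_assoc, ← hc, Finset.mul_sum]
  refine Finset.sum_congr rfl fun j _ => ?_
  have h := ha (i, k, j)
  simp only [algebraMap_int_eq, eq_intCast, zsmul_eq_mul] at h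
  have h' : (a (i, k, j) : ℝ) = D * (c i k j : ℝ) := by exact_mod_cast congrArg (Rat.cast : ℚ → ℝ) h
  rw [Rat.smul_def, h', mul_assoc]

/-- An integral linear relation between `ℚ`-linearly independent reals is trivial. -/
theorem LinearIndependent.eq_zero_of_sum_int_mul_eq_zero {ι : Type*} [Fintype ι] {v : ι → ℝ}
    (hlin : LinearIndependent ℚ v) {w : ι → ℤ} (h : ∑ i, (w i : ℝ) * v i = 0) : w = 0 := by
  funext i
  have := Fintype.linearIndependent_iff.1 hlin (fun i => (w i : ℚ)) (by
    simpa [Rat.smul_def] using h) i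
  exact_mod_cast this

open Matrix in
/-- An integer matrix with a nonzero eigenvalue at a vector with `ℚ`-linearly independent
coordinates is nonsingular. -/
theorem LinearIndependent.det_ne_zero_of_int_eigenvector {ι : Type*} [Fintype ι] [DecidableEq ι]
    {v : ι → ℝ} (hlin : LinearIndependent ℚ v) {A : Matrix ι ι ℤ} {γ : ℝ} (hγ : γ ≠ 0)
    (hA : ∀ k, ∑ j, (A k j : ℝ) * v j = γ * v k) : A.det ≠ 0 := by
  intro hdet
  -- A left kernel vector `w` gives 0 = wAv = γ (w·v), so w·v = 0.
  obtain ⟨w, hw, hwA⟩ := exists_vecMul_eq_zero_iff.2 hdet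
  refine hw (hlin.eq_zero_of_sum_int_mul_eq_zero ?_)
  have h1 : ∑ k, (w k : ℝ) * ∑ j, (A k j : ℝ) * v j = 0 := by
    simp_rw [Finset.mul_sum]
    rw [Finset.sum_comm]
    refine Finset.sum_eq_zero fun j _ => ?_
    have h2 : ∑ k, (w k : ℝ) * A k j = 0 := by
      have := congrFun hwA j
      simp only [vecMul, dotProduct, Pi.zero_apply] at this
      exact_mod_cast this
    simp_rw [← mul_assoc]
    rw [← Finset.sum_mul, h2, zero_mul]
  simp_rw [hA] at h1
  have h3 : γ * ∑ k, (w k : ℝ) * v k = 0 := by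
    rw [← h1, Finset.mul_sum]
    exact Finset.sum_congr rfl fun k _ => by ring
  exact (mul_eq_zero.1 h3).resolve_left hγ

open Matrix in
/-- The images of a nonzero integer vector under the multiplication matrices are linearly
independent. -/
theorem det_mulVec_ne_zero {ι : Type*} [Fintype ι] [DecidableEq ι]
    {v : ι → ℝ} (hlin : LinearIndependent ℚ v) {D : ℤ} (hD : D ≠ 0) {A : ι → Matrix ι ι ℤ}
    (hA : ∀ i k, ∑ j, (A i k j : ℝ) * v j = D * v i * v k) {p : ι → ℤ} (hp : p ≠ 0) :
    (Matrix.of fun k i => (A i *ᵥ p) k).det ≠ 0 := by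
  intro hdet
  obtain ⟨c, hc, hc0⟩ := exists_mulVec_eq_zero_iff.2 hdet
  have hγ : (∑ i, (c i : ℝ) * v i) ≠ 0 := fun h =>
    hc (hlin.eq_zero_of_sum_int_mul_eq_zero h)
  -- `∑ i, c i • A i` has eigenvalue `D * ∑ i, c i * v i` at `v`, yet it would kill `p`.
  have hdet' : (∑ i, c i • A i).det ≠ 0 := by
    refine hlin.det_ne_zero_of_int_eigenvector
      (mul_ne_zero (Int.cast_ne_zero.2 hD : (D : ℝ) ≠ 0) hγ) fun k => ?_
    simp only [Matrix.sum_apply, Matrix.smul_apply, smul_eq_mul, Int.cast_sum, Int.cast_mul,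
      Finset.sum_mul, Finset.mul_sum]
    rw [Finset.sum_comm]
    refine Finset.sum_congr rfl fun i _ => ?_
    simp_rw [mul_assoc]
    rw [← Finset.mul_sum, hA]
    ring
  refine hdet' (exists_mulVec_eq_zero_iff.1 ⟨p, hp, ?_⟩)
  rw [← hc0]
  funext k
  simp only [mulVec, dotProduct, Matrix.of_apply, Matrix.sum_apply, Matrix.smul_apply, smul_eq_mul,
    Finset.sum_mul]
  rw [Finset.sum_comm]
  exact Finset.sum_congr rfl fun i _ => Finset.sum_congr rfl fun j _ => by ring

/-- Dirichlet's theorem on simultaneous approximation. -/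
theorem exists_simultaneous_approx {m : ℕ} (α : Fin m → ℝ) {N : ℕ} (hN : 0 < N) :
    ∃ q : ℤ, 0 < q ∧ q ≤ (N : ℤ) ^ m ∧ ∃ p : Fin m → ℤ, ∀ i, |p i - q * α i| ≤ 1 / N := by
  have hN' : (0 : ℝ) < N := by exact_mod_cast hN
  have hlt : ∀ x : ℝ, ⌊N * Int.fract x⌋₊ < N := fun x => by
    rw [Nat.floor_lt (mul_nonneg hN'.le (Int.fract_nonneg _))]
    nlinarith [Int.fract_lt_one x]
  -- Pigeonhole: N^m + 1 multiples of `α` mod 1 in N^m boxes of side 1/N.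
  let f : Fin (N ^ m + 1) → Fin m → Fin N := fun q i => ⟨⌊N * Int.fract (q * α i)⌋₊, hlt _⟩
  obtain ⟨a, b, hab, hf⟩ := Fintype.exists_ne_map_eq_of_card_lt f (by simp)
  wlog h : a < b generalizing a b
  · exact this b a hab.symm hf.symm (lt_of_le_of_ne (not_lt.1 h) hab.symm)
  refine ⟨(b : ℤ) - a, by have : (a : ℕ) < b := h
                          omega, ?_, fun i => ⌊b * α i⌋ - ⌊a * α i⌋, fun i => ?_⟩
  · have := b.is_lt
    have h2 : (b : ℕ) ≤ N ^ m := by omega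
    have h3 : ((b : ℕ) : ℤ) ≤ (N : ℤ) ^ m := by exact_mod_cast h2
    linarith [Int.natCast_nonneg (a : ℕ)]
  · have h1 : ⌊N * Int.fract (a * α i)⌋₊ = ⌊N * Int.fract (b * α i)⌋₊ :=
      congrArg Fin.val (congrFun hf i)
    have ha0 := Nat.floor_le (mul_nonneg hN'.le (Int.fract_nonneg ((a : ℝ) * α i)))
    have hb0 := Nat.floor_le (mul_nonneg hN'.le (Int.fract_nonneg ((b : ℝ) * α i)))
    have ha1 := Nat.lt_floor_add_one ((N : ℝ) * Int.fract (a * α i))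
    have hb1 := Nat.lt_floor_add_one ((N : ℝ) * Int.fract (b * α i))
    rw [h1] at ha0 ha1
    refine (le_div_iff₀ hN').2 ?_
    rw [← abs_of_pos hN', ← abs_mul]
    have e : (((⌊b * α i⌋ - ⌊a * α i⌋ : ℤ) : ℝ) - (((b : ℤ) - a : ℤ) : ℝ) * α i) * N
        = N * Int.fract (a * α i) - N * Int.fract (b * α i) := by
      simp only [Int.fract]
      push_cast
      ring
    refine (congrArg abs e).trans_le (abs_le.2 ?_)
    constructor <;> linarith

open Matrix in
/-- Covering by translates of a long thin neighbourhood of a segment in direction `v`: modulo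
`ℤ^d`, every point is within `O(1/N)` of a point `τ v` with `τ = O(N^m)`. -/
theorem exists_covering {m : ℕ} (K : IntermediateField ℚ ℝ)
    (hK : Module.finrank ℚ K = m + 1) (α : Fin m → ℝ) (hα : ∀ i, α i ∈ K)
    (hlin : LinearIndependent ℚ (Fin.cons 1 α : Fin (m + 1) → ℝ)) :
    ∃ G H : ℝ, 0 < G ∧ 0 < H ∧ ∀ N : ℕ, 0 < N → ∀ x : Fin (m + 1) → ℝ,
      ∃ τ : ℝ, |τ| ≤ G * (N : ℝ) ^ m ∧ ∃ z : Fin (m + 1) → ℝ, (∀ k, |z k| ≤ H / N) ∧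
        ∃ u : Fin (m + 1) → ℤ,
          ∀ k, x k = u k + τ * (Fin.cons 1 α : Fin (m + 1) → ℝ) k + z k := by
  set v : Fin (m + 1) → ℝ := Fin.cons 1 α with hvdef
  have hv : ∀ i, v i ∈ K := fun i => by
    refine Fin.cases ?_ (fun j => ?_) i
    · exact K.one_mem
    · exact hα j
  obtain ⟨D, hD, A, hA⟩ := exists_int_matrix_mulVec_eq_smul K (by simpa using hK) v hv hlin
  obtain ⟨G, hG⟩ : ∃ G : ℝ, G = ∑ i, |D * v i| := ⟨_, rfl⟩
  obtain ⟨H, hH⟩ : ∃ H : ℝ, H = ∑ i, ∑ k, ∑ j, |(A i k j : ℝ)| := ⟨_, rfl⟩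
  have hG0 : 0 ≤ G := by rw [hG]; positivity
  have hH0 : 0 ≤ H := by rw [hH]; positivity
  refine ⟨G + 1, H + 1, by positivity, by positivity, fun N hN x => ?_⟩
  have hN' : (0 : ℝ) < N := by exact_mod_cast hN
  obtain ⟨q, hq0, hqN, p', hp'⟩ := exists_simultaneous_approx α hN
  have hq0' : (0 : ℝ) < q := by exact_mod_cast hq0
  have hqN' : (q : ℝ) ≤ (N : ℝ) ^ m := by exact_mod_cast hqN
  set p : Fin (m + 1) → ℤ := Fin.cons q p' with hp
  have hpne : p ≠ 0 := fun h => hq0.ne' (by simpa [hp] using congrFun h 0)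
  set y : Fin (m + 1) → ℝ := fun k => p k - q * v k with hy
  have hyN : ∀ k, |y k| ≤ 1 / N := fun k => by
    refine Fin.cases ?_ (fun j => ?_) k
    · simp [hy, hp, hvdef]
    · simpa [hy, hp, hvdef] using hp' j
  set B : Matrix (Fin (m + 1)) (Fin (m + 1)) ℤ := Matrix.of fun k i => (A i *ᵥ p) k with hB
  have hdet : B.det ≠ 0 := det_mulVec_ne_zero hlin hD hA hpne
  have hBentry : ∀ k i, (B k i : ℝ) = q * (D * v i) * v k + ∑ j, (A i k j : ℝ) * y j := by
    intro k i
    simp only [hB, Matrix.of_apply, mulVec, dotProduct, hy, mul_sub, Finset.sum_sub_distrib]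
    have : ∑ j, (A i k j : ℝ) * (q * v j) = q * (D * v i) * v k := by
      rw [mul_assoc (q : ℝ), ← hA, Finset.mul_sum]
      exact Finset.sum_congr rfl fun j _ => by ring
    rw [this]
    push_cast
    ring
  have hunit : IsUnit (B.map (Int.cast : ℤ → ℝ)).det := by
    rw [isUnit_iff_ne_zero]
    have : (B.map (Int.cast : ℤ → ℝ)).det = (B.det : ℝ) :=
      ((Int.castRingHom ℝ).map_det B).symm
    rw [this]
    exact_mod_cast hdet
  -- Coordinates of `x` in the basis of columns of `B`: floors give the lattice point `u`,
  -- fractional parts the point of the parallelepiped.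
  obtain ⟨c, hc⟩ : ∃ c : Fin (m + 1) → ℝ, (B.map (Int.cast : ℤ → ℝ)) *ᵥ c = x :=
    ⟨(B.map (Int.cast : ℤ → ℝ))⁻¹ *ᵥ x, by
      rw [mulVec_mulVec, Matrix.mul_nonsing_inv _ hunit, one_mulVec]⟩
  have hfr : ∀ i, |Int.fract (c i)| ≤ 1 := fun i => by
    rw [abs_of_nonneg (Int.fract_nonneg _)]
    exact (Int.fract_lt_one _).le
  refine ⟨∑ i, Int.fract (c i) * (q * (D * v i)), ?_,
    fun k => ∑ i, Int.fract (c i) * ∑ j, (A i k j : ℝ) * y j, fun k => ?_,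
    fun k => ∑ i, B k i * ⌊c i⌋, fun k => ?_⟩
  · calc |∑ i, Int.fract (c i) * (q * (D * v i))|
        ≤ ∑ i, |Int.fract (c i) * (q * (D * v i))| := Finset.abs_sum_le_sum_abs _ _
      _ ≤ ∑ i, (N : ℝ) ^ m * |D * v i| := by
        refine Finset.sum_le_sum fun i _ => ?_
        rw [abs_mul, abs_mul (q : ℝ), abs_of_pos hq0']
        calc _ ≤ 1 * ((N : ℝ) ^ m * |D * v i|) := by
              gcongr
              exact hfr i
          _ = _ := one_mul _
      _ = G * (N : ℝ) ^ m := by rw [← Finset.mul_sum, mul_comm, hG]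
      _ ≤ _ := by gcongr; linarith
  · calc |∑ i, Int.fract (c i) * ∑ j, (A i k j : ℝ) * y j|
        ≤ ∑ i, |Int.fract (c i) * ∑ j, (A i k j : ℝ) * y j| := Finset.abs_sum_le_sum_abs _ _
      _ ≤ ∑ i, (∑ j, |(A i k j : ℝ)|) * (1 / N) := by
        refine Finset.sum_le_sum fun i _ => ?_
        rw [abs_mul]
        calc _ ≤ 1 * |∑ j, (A i k j : ℝ) * y j| := by
              gcongr
              exact hfr i
          _ ≤ ∑ j, |(A i k j : ℝ) * y j| := by
              rw [one_mul]
              exact Finset.abs_sum_le_sum_abs _ _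
          _ ≤ _ := by
              rw [Finset.sum_mul]
              refine Finset.sum_le_sum fun j _ => ?_
              rw [abs_mul]
              gcongr
              exact hyN j
      _ = (∑ i, ∑ j, |(A i k j : ℝ)|) / N := by rw [← Finset.sum_mul, mul_one_div]
      _ ≤ (H + 1) / N := by
        gcongr
        rw [hH]
        refine le_trans (Finset.sum_le_sum fun i _ => ?_) (le_add_of_nonneg_right zero_le_one)
        exact Finset.single_le_sum (f := fun k => ∑ j, |(A i k j : ℝ)|)
          (fun _ _ => by positivity) (Finset.mem_univ k)
  · have h1 : x k = ∑ i, (B k i : ℝ) * c i := by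
      rw [← hc]
      rfl
    rw [h1, Finset.sum_mul]
    push_cast
    rw [← Finset.sum_add_distrib, ← Finset.sum_add_distrib]
    refine Finset.sum_congr rfl fun i _ => ?_
    have h2 := Int.floor_add_fract (c i)
    have h3 : (B k i : ℝ) * c i = B k i * ⌊c i⌋ + B k i * Int.fract (c i) := by
      rw [← mul_add, h2]
    rw [h3, hBentry]
    ring

theorem lemma6p1p2 (m : ℕ) (hm : 1 ≤ m) (K : IntermediateField ℚ ℝ)
    (hK : Module.finrank ℚ K = m + 1) (α : Fin m → ℝ) (hα : ∀ i, α i ∈ K)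
    (hlin : LinearIndependent ℚ (Fin.cons 1 α : Fin (m + 1) → ℝ)) :
    ∃ C : ℝ, 0 < C ∧ ∀ s : EuclideanSpace ℝ (Fin (m + 1)),
      SuperdenseWith C s (WithLp.toLp 2 (Fin.cons 1 α : Fin (m + 1) → ℝ)) := by
  obtain ⟨G, H, hG, hH, hcov⟩ := exists_covering K hK α hα hlin
  set w : Fin (m + 1) → ℝ := Fin.cons 1 α with hw
  set v : EuclideanSpace ℝ (Fin (m + 1)) := WithLp.toLp 2 w with hv
  have hvne : v ≠ 0 := fun h => by
    have h0 : v 0 = 0 := by rw [h]; rfl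
    simp [hv, hw] at h0
  have hvpos : 0 < ‖v‖ := norm_pos_iff.2 hvne
  obtain ⟨r, hr⟩ := exists_nat_gt (2 * (m + 1 : ℝ) * H)
  have hr0 : (0 : ℝ) < r := lt_trans (by positivity) hr
  have hr0' : 0 < r := by exact_mod_cast hr0
  refine ⟨2 * (G * (r : ℝ) ^ m) * ‖v‖, by positivity, fun s n hn P hP => ?_⟩
  have hn0 : (0 : ℝ) < n := by exact_mod_cast hn
  have hn1 : (1 : ℝ) ≤ n := by exact_mod_cast hn
  have hm1 : (1 : ℝ) ≤ m := by exact_mod_cast hm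
  -- Clamping `P` and the error `z` cost ε each per coordinate; m+1 crudely bounds √(m+1).
  set ε : ℝ := 1 / (2 * (m + 1) * n) with hε
  have hε0 : 0 < ε := by positivity
  have hε2 : ε ≤ 1 / 2 := by
    rw [hε]
    gcongr
    nlinarith
  have hHε : H / ((r * n : ℕ) : ℝ) < ε := by
    rw [hε, div_lt_div_iff₀ (by positivity) (by positivity)]
    push_cast
    nlinarith
  set T : ℝ := G * ((r * n : ℕ) : ℝ) ^ m with hT
  -- Clamping the target to [ε, 1-ε] prevents wrap-around in the cube; subtracting `T * w k` moves
  -- the time from [-T, T] to [0, 2T].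
  obtain ⟨τ, hτ, z, hz, u, hu⟩ := hcov (r * n) (by positivity)
    (fun k => max ε (min (P k) (1 - ε)) - s k - T * w k)
  have hfract : ∀ k, Int.fract (s k + (T + τ) * v k) = max ε (min (P k) (1 - ε)) - z k := by
    intro k
    have hzk := abs_lt.1 ((hz k).trans_lt hHε)
    rw [Int.fract_eq_iff]
    refine ⟨?_, ?_, -u k, ?_⟩
    · linarith [le_max_left ε (min (P k) (1 - ε))]
    · have : max ε (min (P k) (1 - ε)) ≤ 1 - ε :=
        max_le (by linarith) (min_le_right _ _)
      linarith
    · have h := hu k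
      have hvk : v k = w k := rfl
      rw [hvk]
      push_cast
      linarith
  obtain ⟨hτ1, hτ2⟩ := abs_le.1 hτ
  refine ⟨torusLine s v (T + τ), ⟨T + τ, by linarith, ?_, rfl⟩, ?_⟩
  · have h1 : 2 * (G * (r : ℝ) ^ m) * ‖v‖ * (n : ℝ) ^ (m + 1 - 1) = 2 * T * ‖v‖ := by
      rw [hT, Nat.add_sub_cancel]
      push_cast
      ring
    rw [h1]
    gcongr
    linarith
  · have hcoord : ∀ k, dist (torusLine s v (T + τ) k) (P k) ≤ 2 * ε := by
      intro k
      have e : torusLine s v (T + τ) k = max ε (min (P k) (1 - ε)) - z k := hfract k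
      rw [e, Real.dist_eq]
      have hzk := abs_lt.1 ((hz k).trans_lt hHε)
      obtain ⟨hP0, hP1⟩ := hP k
      rw [abs_le]
      constructor
      · have : P k - ε ≤ max ε (min (P k) (1 - ε)) :=
          le_max_of_le_right (le_min (by linarith) (by linarith))
        linarith
      · have : max ε (min (P k) (1 - ε)) ≤ P k + ε :=
          max_le (by linarith) ((min_le_left _ _).trans (by linarith))
        linarith
    rw [EuclideanSpace.dist_eq]
    refine Real.sqrt_le_iff.2 ⟨by positivity, ?_⟩
    calc ∑ k, dist (torusLine s v (T + τ) k) (P k) ^ 2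
        ≤ ∑ _k : Fin (m + 1), (2 * ε) ^ 2 :=
          Finset.sum_le_sum fun k _ => pow_le_pow_left₀ dist_nonneg (hcoord k) 2
      _ = (m + 1) * (2 * ε) ^ 2 := by simp
      _ ≤ ((m + 1) * (2 * ε)) ^ 2 := by
        rw [mul_pow (m + 1 : ℝ)]
        have h1 : (m + 1 : ℝ) ≤ (m + 1) ^ 2 := by nlinarith
        exact mul_le_mul_of_nonneg_right h1 (sq_nonneg _)
      _ = (1 / n) ^ 2 := by
        congr 1
        rw [hε]
        field_simp
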